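/- Let $n,d\in\mathbb{N}$, $Y=(0,1)^d$, $\Theta=[-\pi,\pi)^d$, and equip $\mathbb{C}^{n\times d}$ with the Frobenius inner product. For $\theta\in\Theta$ let $H^1_\theta(Y)$ be the closure in the $H^1(Y)$ norm of the smooth functions $\phi$ on $\mathbb{R}^d$ with $\phi(\cdot+k)=e^{\mathrm{i}\theta\cdot k}\phi$ $(k\in\mathbb{Z}^d)$. Let $\mathrm{grad}_\theta\colon [H^1_\theta(Y)]^n\subseteq[L^2(Y)]^n\to[L^2(Y)]^{n\times d}$, $(\phi_i)_i\mapsto(\partial_j\phi_i)_{i,j}$, and $\mathrm{div}_\#:=-(\mathrm{grad}_0)^*$. Let $a\in L^\infty(\mathbb{R}^d;L(\mathbb{C}^{n\times d}))$ be $\mathbb{Z}^d$-periodic, coercive ($\mathrm{Re}\,a\ge\nu$ a.e. for some $\nu>0$) and self-adjoint, with $aX\in\ker(\mathrm{div}_\#)$ for all $X\in\mathbb{C}^{n\times d}$. Then for all $\theta\in\Theta$, $r\in\{1,\dots,n\}$, $s\in\{1,\dots,d\}$ there is a unique $N^{(rs)}_\theta\in[H^1_\theta(Y)]^n$ with components orthogonal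 in $L^2(Y)$ to $e^{\mathrm{i}\theta\cdot y}$ such that $$\big\langle a[\mathrm{grad}_\theta N^{(rs)}_\theta+e^{\mathrm{i}\theta\cdot y}\,e_r\otimes e_s],\,\mathrm{grad}_\theta\phi\big\rangle_{L^2(Y)}=0$$ for all $\phi\in[H^1_\theta(Y)]^n$ with components orthogonal to $e^{\mathrm{i}\theta\cdot y}$. With $a_{ijkl}$ the components of $a$, $(aX)_{ij}=\sum_{k,l}a_{ijkl}X_{kl}$, define $$a^{\mathrm{hom}}_{ijrs}(\theta):=\sum_{k=1}^n\sum_{l=1}^d\int_Y a_{ijkl}\big(\partial_l N^{(rs)}_{\theta k}+e^{\mathrm{i}\theta\cdot y}\delta_{kr}\delta_{ls}\big)e^{-\mathrm{i}\theta\cdot y}\,dy .$$ Then $$a^{\mathrm{hom}}(\theta)=a^{\mathrm{hom}}(0)\ \text{ for all }\theta\in\Theta\setminus\{0\}\quad\Longleftrightarrow\quad a\text{ is constant (almost everywhere)}.$$ Moreover, the fibre-homogenised tensor differs from the classical one in general: if $n\ge1$ and $d\ge2$, there are an $a$ as above and a $\theta\in\Theta\setminus\{0\}$ with $a^{\mathrm{hom}}(\theta)\neq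 a^{\mathrm{hom}}(0)$. -/

import Mathlib

open MeasureTheory Complex
open scoped ContDiff

namespace FibreHom

/-- `ℝ^d` with the Euclidean norm and Lebesgue measure. -/
abbrev Pt (d : ℕ) := EuclideanSpace ℝ (Fin d)

/-- `ℂ^n`. -/
abbrev Vec (n : ℕ) := EuclideanSpace ℂ (Fin n)

/-- `ℂ^{n × d}` with the Frobenius inner product. -/
abbrev Mat (n d : ℕ) := EuclideanSpace ℂ (Fin n × Fin d)

/-- `L(ℂ^{n × d})`. -/
abbrev Tensor (n d : ℕ) := Mat n d →L[ℂ] Mat n d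

/-- The periodicity cell `Y = (0,1)^d`. -/
def cell (d : ℕ) : Set (Pt d) := {y | ∀ j, y j ∈ Set.Ioo (0 : ℝ) 1}

/-- Lebesgue measure on `Y`. -/
noncomputable abbrev cellMeasure (d : ℕ) : Measure (Pt d) := volume.restrict (cell d)

/-- `Θ = [-π, π)^d`. -/
def quasimomenta (d : ℕ) : Set (Pt d) := {θ | ∀ j, θ j ∈ Set.Ico (-Real.pi) Real.pi}

/-- The point of `ℝ^d` with integer coordinates `k`. -/
noncomputable def latticePt {d : ℕ} (k : Fin d → ℤ) : Pt d := WithLp.toLp 2 fun j => (k j : ℝ)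

/-- The plane wave `y ↦ exp(i θ · y)`. -/
noncomputable def wave {d : ℕ} (θ y : Pt d) : ℂ := cexp (I * ((∑ j, θ j * y j : ℝ) : ℂ))

/-- The matrix unit `e_r ⊗ e_s`. -/
noncomputable def matUnit {n d : ℕ} (r : Fin n) (s : Fin d) : Mat n d :=
  EuclideanSpace.single (r, s) 1

/-- The class of coefficients `a ∈ L^∞(ℝ^d; L(ℂ^{n × d}))` that are `ℤ^d`-periodic and coercive,
`Re a ≥ ν`, for some `ν > 0`.  All conditions are on the `L^∞`-class of `a`, hence hold a.e. -/
structure PeriodicCoercive {n d : ℕ} (a : Pt d → Tensor n d) : Prop where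
  memLp : MemLp a ⊤ (volume : Measure (Pt d))
  periodic : ∀ k : Fin d → ℤ, ∀ᵐ x : Pt d, a (x + latticePt k) = a x
  coercive : ∃ ν : ℝ, 0 < ν ∧ ∀ᵐ x : Pt d, ∀ X : Mat n d, ν * ‖X‖ ^ 2 ≤ (inner ℂ X (a x X)).re

/-- `[L²(Y)]^n`. -/
noncomputable abbrev L2Vec (n d : ℕ) := Lp (Vec n) 2 (cellMeasure d)

/-- `[L²(Y)]^{n × d}`. -/
noncomputable abbrev L2Mat (n d : ℕ) := Lp (Mat n d) 2 (cellMeasure d)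

/-- `[C^∞_θ(Y)]^n`: smooth `φ : ℝ^d → ℂ^n` with `φ(x + k) = exp(i θ · k) φ(x)` for `k ∈ ℤ^d`. -/
structure SmoothQuasiPeriodic {n d : ℕ} (θ : Pt d) (φ : Pt d → Vec n) : Prop where
  smooth : ContDiff ℝ ∞ φ
  quasiPeriodic : ∀ (k : Fin d → ℤ) (x : Pt d),
    φ (x + latticePt k) = wave θ (latticePt k) • φ x

/-- The classical gradient `(∂_j φ_i)_{i,j}` of `φ : ℝ^d → ℂ^n`. -/
noncomputable def gradient {n d : ℕ} (φ : Pt d → Vec n) (y : Pt d) : Mat n d :=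
  WithLp.toLp 2 fun p => fderiv ℝ φ y (EuclideanSpace.single p.2 1) p.1

/-- The graph of the operator `grad_θ : [H¹_θ(Y)]^n ⊆ [L²(Y)]^n → [L²(Y)]^{n × d}`.
The space `H¹_θ(Y)` is the closure of `C^∞_θ(Y)` in the norm of `H¹(Y)`.  Hence `u ∈ [H¹_θ(Y)]^n`
and `G = grad_θ u` if and only if `(u, G)` is a limit in `L² × L²` of pairs `(φ, grad φ)` with
`φ ∈ [C^∞_θ(Y)]^n`. -/
def gradGraph {n d : ℕ} (θ : Pt d) : Set (L2Vec n d × L2Mat n d) :=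
  closure {p | ∃ φ : Pt d → Vec n, SmoothQuasiPeriodic θ φ ∧
    (p.1 : Pt d → Vec n) =ᵐ[cellMeasure d] φ ∧
    (p.2 : Pt d → Mat n d) =ᵐ[cellMeasure d] gradient φ}

/-- `q ∈ dom(div_θ)` and `div_θ q = f`, where `div_θ = -(grad_θ)^*` is the negative of the
Hilbert space adjoint of `grad_θ`. -/
def HasDiv {n d : ℕ} (θ : Pt d) (q : L2Mat n d) (f : L2Vec n d) : Prop :=
  ∀ p ∈ gradGraph (n := n) θ, inner ℂ p.2 q = -inner ℂ p.1 f

/-- `ker(div_θ)`.  The periodic case, `div_#`, is `θ = 0`. -/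
def kerDiv {n d : ℕ} (θ : Pt d) : Set (L2Mat n d) := {q | HasDiv θ q 0}

/-- `u ⊥ exp(i θ · y)` in `L²(Y)`, for every component of `u`. -/
def OrthWave {n d : ℕ} (θ : Pt d) (u : L2Vec n d) : Prop :=
  ∀ i, ∫ y in cell d, starRingEnd ℂ (wave θ y) * u y i = 0

/-- The cell problem with data `(r, s)`: `p = (N, grad_θ N)` with
`N ∈ [H¹_θ(Y) ⊥ exp(i θ · y)]^n` and
`⟨a [grad_θ N + exp(i θ · y) e_r ⊗ e_s], grad_θ φ⟩ = 0` for all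
`φ ∈ [H¹_θ(Y) ⊥ exp(i θ · y)]^n`. -/
structure IsCellSolution {n d : ℕ} (a : Pt d → Tensor n d) (θ : Pt d) (r : Fin n) (s : Fin d)
    (p : L2Vec n d × L2Mat n d) : Prop where
  mem_gradGraph : p ∈ gradGraph θ
  orthWave : OrthWave θ p.1
  eq_zero : ∀ t ∈ gradGraph (n := n) θ, OrthWave θ t.1 →
    ∫ y in cell d, inner ℂ (t.2 y) (a y (p.2 y + wave θ y • matUnit r s)) = 0

/-- The solution `(N^{(rs)}_θ, grad_θ N^{(rs)}_θ)` of the cell problem. -/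
noncomputable def cellSolution {n d : ℕ} (a : Pt d → Tensor n d) (θ : Pt d) (r : Fin n)
    (s : Fin d) : L2Vec n d × L2Mat n d :=
  Classical.epsilon (IsCellSolution a θ r s)

/-- The components `A_{ijkl}` of `A ∈ L(ℂ^{n × d})`, with `(A X)_{ij} = ∑_{k,l} A_{ijkl} X_{kl}`.
For self-adjoint `A` this is the same as `inner ℂ (A (matUnit i j)) (matUnit k l)`. -/
noncomputable def component {n d : ℕ} (A : Tensor n d) (i : Fin n) (j : Fin d) (k : Fin n)
    (l : Fin d) : ℂ :=
  inner ℂ (matUnit i j) (A (matUnit k l))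

/-- The fibre-homogenised tensor, given by its components
`a^hom_{ijrs}(θ) = ∑_{k,l} ∫_Y a_{ijkl} (∂_l N^{(rs)}_{θ k} + exp(iθ·y) δ_{kr} δ_{ls}) exp(-iθ·y) dy`.
-/
noncomputable def aHom {n d : ℕ} (a : Pt d → Tensor n d) (θ : Pt d) (i : Fin n) (j : Fin d)
    (r : Fin n) (s : Fin d) : ℂ :=
  ∑ k : Fin n, ∑ l : Fin d, ∫ y in cell d,
    component (a y) i j k l *
      ((cellSolution a θ r s).2 y (k, l) +
        wave θ y * ((if k = r then 1 else 0) * (if l = s then 1 else 0))) * wave (-θ) y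

/-- The standing assumptions: `a` is periodic and coercive, self-adjoint, and
`a X ∈ ker(div_#)` for all `X ∈ ℂ^{n × d}`. -/
structure SelfAdjointDivFree {n d : ℕ} (a : Pt d → Tensor n d) : Prop where
  periodicCoercive : PeriodicCoercive a
  selfAdjoint : ∀ᵐ x : Pt d, IsSelfAdjoint (a x)
  divFree : ∀ X : Mat n d, ∃ q ∈ kerDiv (n := n) (d := d) 0,
    (q : Pt d → Mat n d) =ᵐ[cellMeasure d] fun y => a y X

/-- `a` is constant, as an element of `L^∞`. -/
def IsConstant {n d : ℕ} (a : Pt d → Tensor n d) : Prop :=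
  ∃ A : Tensor n d, ∀ᵐ x : Pt d, a x = A

end FibreHom

/-!
Expand in the plane waves `exp(i (θ + 2πk) · y)`, `k ∈ ℤ^d`. By Parseval's identity `grad_θ` is
multiplication by its symbol `v ↦ i v ⊗ (θ + 2πk)`, which for `θ ∈ [-π, π)^d` and `k ≠ 0` expands
norms by at least `π`. Hence `grad_θ` has closed range on the orthogonal complement of
`exp(i θ · y)`, and coercivity of `a` solves the cell problem by the Lax–Milgram argument.

Since `a X` is divergence free, the corrector at `θ = 0` vanishes and `a^hom(0)` is the mean of `a`.
For self-adjoint `a`, the diagonal entries of `a^hom(θ)` and of the mean differ by the energy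
`⟨grad N, a grad N⟩` of the corrector `N`, so equality forces `grad N = 0`. Thus the `k`-th Fourier
coefficient of `a X`, `k ≠ 0`, is orthogonal to `v ⊗ (θ + 2πk)` for all `v`; comparing `θ = 0` with
`θ = e_j` shows that it is orthogonal to every `v ⊗ e_j`, hence zero, and `a` is constant. For
`d ≥ 2` a laminate is a nonconstant example.
-/

namespace FibreHom

section CoerciveOperator

variable {𝕜 E : Type*} [RCLike 𝕜] [NormedAddCommGroup E] [InnerProductSpace 𝕜 E] {T : E →L[𝕜] E}

/-- Coercivity of an operator on a Hilbert space: `Re T ≥ ν` for some `ν > 0`.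
Mathlib's `IsCoercive` is the corresponding notion for real bilinear forms. -/
def IsCoerciveOperator (T : E →L[𝕜] E) : Prop :=
  ∃ ν : ℝ, 0 < ν ∧ ∀ x, ν * ‖x‖ ^ 2 ≤ RCLike.re (inner 𝕜 x (T x))

lemma IsCoerciveOperator.eq_zero_of_inner_eq_zero (hT : IsCoerciveOperator T) {x : E}
    (hx : inner 𝕜 x (T x) = 0) : x = 0 := by
  obtain ⟨ν, hν, hbound⟩ := hT
  have hle : ν * ‖x‖ ^ 2 ≤ 0 := by simpa only [hx, map_zero] using hbound x
  have hsq : ‖x‖ ^ 2 = 0 := le_antisymm (nonpos_of_mul_nonpos_right hle hν) (sq_nonneg _)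
  simpa using hsq

lemma IsCoerciveOperator.isUnit [CompleteSpace E] (hT : IsCoerciveOperator T) : IsUnit T := by
  obtain ⟨ν, hν, hbound⟩ := hT
  refine T.isUnit_of_forall_le_norm_inner_map (c := ⟨ν, hν.le⟩) hν fun x => ?_
  rw [norm_inner_symm, mul_comm]
  exact (hbound x).trans (RCLike.re_le_norm _)

lemma IsCoerciveOperator.compression (hT : IsCoerciveOperator T) (W : Submodule 𝕜 E)
    [W.HasOrthogonalProjection] :
    IsCoerciveOperator (W.orthogonalProjectionOnto ∘L T ∘L W.subtypeL) := by
  obtain ⟨ν, hν, hbound⟩ := hT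
  refine ⟨ν, hν, fun w => (hbound w).trans_eq (congrArg RCLike.re ?_)⟩
  exact (Submodule.inner_orthogonalProjectionOnto_eq_of_mem_left w (T w)).symm

theorem IsCoerciveOperator.existsUnique_map_add_mem_orthogonal (hT : IsCoerciveOperator T)
    (W : Submodule 𝕜 E) [CompleteSpace W] (f : E) : ∃! w, w ∈ W ∧ T (w + f) ∈ Wᗮ := by
  obtain ⟨w, hw, huniq⟩ := (ContinuousLinearMap.isUnit_iff_bijective.1
    (hT.compression W).isUnit).existsUnique (-W.orthogonalProjectionOnto (T f))
  have hiff : ∀ v : W, (W.orthogonalProjectionOnto ∘L T ∘L W.subtypeL) v =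
      -W.orthogonalProjectionOnto (T f) ↔ T (v + f) ∈ Wᗮ := fun v => by
    rw [← Submodule.orthogonalProjectionOnto_eq_zero_iff, map_add, map_add, eq_neg_iff_add_eq_zero]
    rfl
  refine ⟨w, ⟨w.2, (hiff w).1 hw⟩, fun v ⟨hv, hvf⟩ => ?_⟩
  exact congrArg Subtype.val (huniq ⟨v, hv⟩ ((hiff ⟨v, hv⟩).2 hvf))

/- Orthogonality gives `⟪w, T f⟫ = -⟪w, T w⟫`, so by symmetry the energies `⟪f, T (w + f)⟫` and
`⟪f, T f⟫` differ by the coercive term `⟪w, T w⟫`. -/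
theorem IsCoerciveOperator.eq_zero_of_inner_map_add_eq (hT : IsCoerciveOperator T)
    (hsymm : (T : E →ₗ[𝕜] E).IsSymmetric) {W : Submodule 𝕜 E} {w f : E} (hw : w ∈ W)
    (hwf : T (w + f) ∈ Wᗮ) (henergy : inner 𝕜 f (T (w + f)) = inner 𝕜 f (T f)) : w = 0 := by
  refine hT.eq_zero_of_inner_eq_zero ?_
  have hfw : inner 𝕜 f (T w) = 0 := by simpa [inner_add_right] using henergy
  have hwf' : inner 𝕜 w (T f) = 0 := by
    rw [← inner_conj_symm, ← ContinuousLinearMap.coe_coe T, hsymm f w, ContinuousLinearMap.coe_coe,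
      hfw, map_zero]
  simpa only [map_add, inner_add_right, hwf', add_zero] using hwf w hw

end CoerciveOperator

section MulOp

variable {α 𝕜 E : Type*} {mα : MeasurableSpace α} {μ : Measure α} [RCLike 𝕜]
  [NormedAddCommGroup E] [InnerProductSpace 𝕜 E] {a : α → E →L[𝕜] E}

/-- Multiplication by a bounded operator-valued function `a` on `L²`. -/
noncomputable def mulOp (ha : MemLp a ⊤ μ) : Lp E 2 μ →L[𝕜] Lp E 2 μ :=
  (ContinuousLinearMap.id 𝕜 (E →L[𝕜] E)).holderL μ ⊤ 2 2 ha.toLp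

lemma coeFn_mulOp (ha : MemLp a ⊤ μ) (u : Lp E 2 μ) :
    mulOp ha u =ᵐ[μ] fun x => a x (u x) := by
  filter_upwards [(ContinuousLinearMap.id 𝕜 (E →L[𝕜] E)).coeFn_holder (r := 2) ha.toLp u,
    ha.coeFn_toLp] with x hholder hx
  rw [mulOp, ContinuousLinearMap.holderL_apply_apply, hholder, hx]
  rfl

lemma isCoerciveOperator_mulOp (ha : MemLp a ⊤ μ) {ν : ℝ} (hν : 0 < ν)
    (hbound : ∀ᵐ x ∂μ, ∀ v, ν * ‖v‖ ^ 2 ≤ RCLike.re (inner 𝕜 v (a x v))) :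
    IsCoerciveOperator (mulOp ha) := by
  refine ⟨ν, hν, fun u => ?_⟩
  rw [@norm_sq_eq_re_inner 𝕜, L2.inner_def, L2.inner_def, ← integral_re (L2.integrable_inner u u),
    ← integral_re (L2.integrable_inner u (mulOp ha u)), ← integral_const_mul]
  refine integral_mono_ae ((L2.integrable_inner u u).re.const_mul ν)
    (L2.integrable_inner u (mulOp ha u)).re ?_
  filter_upwards [coeFn_mulOp ha u, hbound] with x hx hνx
  rw [hx, inner_self_eq_norm_sq]
  exact hνx (u x)

lemma isSymmetric_mulOp (ha : MemLp a ⊤ μ) (hsymm : ∀ᵐ x ∂μ, (a x : E →ₗ[𝕜] E).IsSymmetric) :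
    (mulOp ha : Lp E 2 μ →ₗ[𝕜] Lp E 2 μ).IsSymmetric := by
  intro u v
  rw [L2.inner_def, L2.inner_def]
  refine integral_congr_ae ?_
  filter_upwards [coeFn_mulOp ha u, coeFn_mulOp ha v, hsymm] with x hu hv hx
  rw [ContinuousLinearMap.coe_coe, hu, hv]
  exact hx (u x) (v x)

end MulOp

section Wave

variable {d : ℕ}

lemma wave_eq_exp_inner (θ y : Pt d) : wave θ y = cexp (I * (inner ℝ θ y : ℝ)) := by
  simp only [wave, PiLp.inner_apply, RCLike.inner_apply, conj_trivial, mul_comm]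

lemma wave_add_left (θ ξ y : Pt d) : wave (θ + ξ) y = wave θ y * wave ξ y := by
  simp only [wave_eq_exp_inner, inner_add_left, ofReal_add, mul_add, Complex.exp_add]

lemma wave_add_right (θ y z : Pt d) : wave θ (y + z) = wave θ y * wave θ z := by
  simp only [wave_eq_exp_inner, inner_add_right, ofReal_add, mul_add, Complex.exp_add]

@[simp] lemma wave_zero_left (y : Pt d) : wave 0 y = 1 := by simp [wave]

@[simp] lemma norm_wave (θ y : Pt d) : ‖wave θ y‖ = 1 := by
  rw [wave, mul_comm, norm_exp_ofReal_mul_I]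

lemma conj_wave (θ y : Pt d) : starRingEnd ℂ (wave θ y) = wave (-θ) y := by
  simp only [wave_eq_exp_inner, ← exp_conj, map_mul, conj_I, conj_ofReal, inner_neg_left,
    ofReal_neg, neg_mul, mul_neg]

lemma wave_mul_wave_neg (θ y : Pt d) : wave θ y * wave (-θ) y = 1 := by
  rw [← wave_add_left, add_neg_cancel, wave_zero_left]

lemma contDiff_wave (θ : Pt d) : ContDiff ℝ ∞ (wave θ) := by
  simp only [funext (wave_eq_exp_inner θ)]
  exact (contDiff_const.mul (ofRealCLM.contDiff.comp (innerSL ℝ θ).contDiff)).cexp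

lemma continuous_wave (θ : Pt d) : Continuous (wave θ) := (contDiff_wave θ).continuous

lemma fderiv_wave (θ y v : Pt d) : fderiv ℝ (wave θ) y v = I * (inner ℝ θ v : ℝ) * wave θ y := by
  have hphase : HasFDerivAt (fun y : Pt d => ((inner ℝ θ y : ℝ) : ℂ))
      (ofRealCLM ∘L innerSL ℝ θ) y := (ofRealCLM ∘L innerSL ℝ θ).hasFDerivAt
  simp only [funext (wave_eq_exp_inner θ), (hphase.const_mul I).cexp.fderiv,
    smul_apply, ContinuousLinearMap.comp_apply, innerSL_apply_apply,
    ofRealCLM_apply, smul_eq_mul]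
  ring

/-- The frequencies `θ + 2πk`, `k ∈ ℤ^d`, of the `θ`-quasi-periodic plane waves. -/
noncomputable def frequency (θ : Pt d) (k : Fin d → ℤ) : Pt d := θ + (2 * Real.pi) • latticePt k

lemma frequency_apply (θ : Pt d) (k : Fin d → ℤ) (j : Fin d) :
    frequency θ k j = θ j + 2 * Real.pi * k j := by
  simp [frequency, latticePt]

@[simp] lemma frequency_zero_right (θ : Pt d) : frequency θ 0 = θ := by
  ext j; simp [frequency_apply]

lemma frequency_eq_add (θ : Pt d) (k : Fin d → ℤ) : frequency θ k = θ + frequency 0 k := by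
  simp [frequency]

lemma frequency_sub_frequency (θ : Pt d) (k m : Fin d → ℤ) :
    frequency θ k - frequency θ m = frequency 0 (k - m) := by
  ext j
  simp only [PiLp.sub_apply, frequency_apply, PiLp.zero_apply, Pi.sub_apply, Int.cast_sub]
  ring

lemma frequency_zero_neg (k : Fin d → ℤ) : frequency 0 (-k) = -frequency 0 k := by
  ext j; simp [frequency_apply]

lemma wave_frequency_zero_latticePt (k m : Fin d → ℤ) :
    wave (frequency 0 k) (latticePt m) = 1 := by
  rw [wave, Complex.exp_eq_one_iff]
  refine ⟨∑ j, k j * m j, ?_⟩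
  simp only [frequency_apply, latticePt, PiLp.zero_apply, zero_add]
  push_cast
  rw [Finset.mul_sum, Finset.sum_mul]
  exact Finset.sum_congr rfl fun j _ => by ring

lemma wave_frequency_latticePt (θ : Pt d) (k m : Fin d → ℤ) :
    wave (frequency θ k) (latticePt m) = wave θ (latticePt m) := by
  rw [frequency_eq_add, wave_add_left, wave_frequency_zero_latticePt, mul_one]

end Wave

section Cell

variable {d : ℕ} {E : Type*} [NormedAddCommGroup E]

lemma cell_eq_preimage :
    cell d = (WithLp.ofLp : Pt d → Fin d → ℝ) ⁻¹' (Set.univ.pi fun _ => Set.Ioo 0 1) := by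
  ext y; simp [cell]

lemma measurableSet_cell : MeasurableSet (cell d) := by
  rw [cell_eq_preimage]
  exact (MeasurableSet.univ_pi fun _ => measurableSet_Ioo).preimage (WithLp.measurable_ofLp _ _)

lemma measurePreserving_ofLp_cell :
    MeasurePreserving (WithLp.ofLp : Pt d → Fin d → ℝ) (cellMeasure d)
      (volume.restrict (Set.univ.pi fun _ => Set.Ioo (0 : ℝ) 1)) := by
  rw [cellMeasure, cell_eq_preimage]
  exact (PiLp.volume_preserving_ofLp (Fin d)).restrict_preimage
    (MeasurableSet.univ_pi fun _ => measurableSet_Ioo)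

lemma volume_cell : volume (cell d) = 1 := by
  rw [cell_eq_preimage, (PiLp.volume_preserving_ofLp (Fin d)).measure_preimage
    (MeasurableSet.univ_pi fun _ => measurableSet_Ioo).nullMeasurableSet, volume_pi,
    Measure.pi_pi]
  simp

instance : IsProbabilityMeasure (cellMeasure d) := ⟨by simp [volume_cell]⟩

lemma setIntegral_cell [NormedSpace ℝ E] (f : Pt d → E) :
    ∫ y in cell d, f y = ∫ x in Set.Icc (0 : Fin d → ℝ) 1, f (WithLp.toLp 2 x) := by
  rw [← setIntegral_congr_set (μ := volume) (f := fun x => f (WithLp.toLp 2 x))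
    (Measure.univ_pi_Ioo_ae_eq_Icc (μ := fun _ : Fin d => (volume : Measure ℝ)) (f := 0) (g := 1))]
  exact measurePreserving_ofLp_cell.integral_comp
    (MeasurableEquiv.toLp 2 (Fin d → ℝ)).symm.measurableEmbedding fun x => f (WithLp.toLp 2 x)

lemma memLp_cell_of_continuous [SecondCountableTopologyEither (Pt d) E] {f : Pt d → E}
    (hf : Continuous f) (p : ENNReal) : MemLp f p (cellMeasure d) := by
  have hcompact : IsCompact ((WithLp.toLp 2 : (Fin d → ℝ) → Pt d) '' Set.Icc 0 1) :=
    isCompact_Icc.image (PiLp.continuous_toLp 2 _)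
  obtain ⟨C, hC⟩ := hcompact.exists_bound_of_continuousOn hf.continuousOn
  refine MemLp.of_bound hf.aestronglyMeasurable C
    ((ae_restrict_iff' measurableSet_cell).2 (.of_forall fun y hy => ?_))
  exact hC y ⟨WithLp.ofLp y, ⟨fun j => (hy j).1.le, fun j => (hy j).2.le⟩, rfl⟩

end Cell

section IntegrationByParts

lemma integral_Icc_fderiv_single_eq_zero {m : ℕ} {E : Type*} [NormedAddCommGroup E]
    [NormedSpace ℝ E] {f : (Fin (m + 1) → ℝ) → E} {j : Fin (m + 1)} (hf : ContDiff ℝ 1 f)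
    (hper : ∀ x, f (x + Pi.single j 1) = f x) :
    ∫ x in Set.Icc 0 1, fderiv ℝ f x (Pi.single j 1) = 0 := by
  have hdiv : ∀ x, ∑ i, (Pi.single j (fderiv ℝ f) : Fin (m + 1) → _) i x (Pi.single i 1) =
      fderiv ℝ f x (Pi.single j 1) := fun x => by
    rw [Finset.sum_eq_single j (fun i _ hij => by simp [hij]) (by simp), Pi.single_eq_same]
  have hdivergence := integral_divergence_of_hasFDerivAt_off_countable' (0 : Fin (m + 1) → ℝ) 1
    (fun _ => zero_le_one) (Pi.single j f) (Pi.single j (fderiv ℝ f)) ∅ Set.countable_empty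
    (fun i => by
      obtain rfl | hij := eq_or_ne i j
      · simpa using hf.continuous.continuousOn
      · rw [Pi.single_eq_of_ne hij]
        exact continuousOn_const)
    (fun x _ i => by
      obtain rfl | hij := eq_or_ne i j
      · simpa using (hf.differentiable one_ne_zero x).hasFDerivAt
      · rw [Pi.single_eq_of_ne hij, Pi.single_eq_of_ne hij]
        exact hasFDerivAt_const 0 x)
    (by
      simp only [hdiv]
      exact ((hf.continuous_fderiv one_ne_zero).clm_apply
        continuous_const).continuousOn.integrableOn_compact isCompact_Icc)
  simp only [hdiv] at hdivergence
  rw [hdivergence]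
  refine Finset.sum_eq_zero fun i _ => ?_
  obtain rfl | hij := eq_or_ne i j
  · have hface : ∀ x, i.insertNth (α := fun _ => ℝ) 1 x =
        i.insertNth (α := fun _ => ℝ) 0 x + Pi.single i 1 := fun x => by
      ext l
      obtain rfl | ⟨l, rfl⟩ := i.eq_self_or_eq_succAbove l <;> simp
    simp only [Pi.single_eq_same, Pi.one_apply, Pi.zero_apply, hface, hper]
    exact sub_self _
  · simp [hij]

variable {d : ℕ}

lemma setIntegral_cell_fderiv_single_eq_zero {E : Type*} [NormedAddCommGroup E] [NormedSpace ℝ E]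
    {f : Pt d → E} {j : Fin d} (hf : ContDiff ℝ 1 f)
    (hper : ∀ y, f (y + EuclideanSpace.single j 1) = f y) :
    ∫ y in cell d, fderiv ℝ f y (EuclideanSpace.single j 1) = 0 := by
  obtain _ | m := d
  · exact j.elim0
  let L : (Fin (m + 1) → ℝ) ≃L[ℝ] Pt (m + 1) := (PiLp.continuousLinearEquiv 2 ℝ _).symm
  have hchain : ∀ x, fderiv ℝ (f ∘ L) x (Pi.single j 1) =
      fderiv ℝ f (L x) (EuclideanSpace.single j 1) := fun x => by
    rw [L.comp_right_fderiv]
    rfl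
  rw [setIntegral_cell, ← integral_Icc_fderiv_single_eq_zero (f := f ∘ L) (j := j)
    (hf.comp L.contDiff) fun x => hper (L x)]
  exact integral_congr_ae (.of_forall fun x => (hchain x).symm)

lemma latticePt_single (j : Fin d) :
    latticePt (Pi.single j 1) = (EuclideanSpace.single j 1 : Pt d) := by
  ext i
  simp [latticePt, Pi.single_apply]

lemma setIntegral_cell_conj_wave_mul_fderiv {θ : Pt d} {g : Pt d → ℂ} (hg : ContDiff ℝ 1 g)
    (hquasi : ∀ k x, g (x + latticePt k) = wave θ (latticePt k) * g x) (k : Fin d → ℤ)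
    (j : Fin d) :
    ∫ y in cell d, starRingEnd ℂ (wave (frequency θ k) y) *
        fderiv ℝ g y (EuclideanSpace.single j 1) =
      I * frequency θ k j * ∫ y in cell d, starRingEnd ℂ (wave (frequency θ k) y) * g y := by
  set ξ := frequency θ k with hξ
  have hwave : ContDiff ℝ 1 (wave (-ξ)) := (contDiff_wave (-ξ)).of_le (by norm_cast)
  have hperiodic : ∀ y, wave (-ξ) (y + EuclideanSpace.single j 1) *
      g (y + EuclideanSpace.single j 1) = wave (-ξ) y * g y := fun y => by
    rw [← latticePt_single, hquasi, wave_add_right, ← conj_wave ξ (latticePt _), hξ,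
      wave_frequency_latticePt, conj_wave, ← hξ]
    linear_combination (wave (-ξ) y * g y) * wave_mul_wave_neg θ (latticePt (Pi.single j 1))
  have hproduct : ∀ y, fderiv ℝ (fun y => wave (-ξ) y * g y) y (EuclideanSpace.single j 1) =
      wave (-ξ) y * fderiv ℝ g y (EuclideanSpace.single j 1) -
        I * ξ j * (wave (-ξ) y * g y) := fun y => by
    rw [fderiv_fun_mul (hwave.differentiable one_ne_zero y) (hg.differentiable one_ne_zero y)]
    simp only [add_apply, smul_apply, fderiv_wave, smul_eq_mul, inner_neg_left,
      EuclideanSpace.inner_single_right, conj_trivial, one_mul, ofReal_neg]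
    ring
  have hzero := setIntegral_cell_fderiv_single_eq_zero (hwave.mul hg) hperiodic
  have hcont_fderiv : Continuous fun y =>
      wave (-ξ) y * fderiv ℝ g y (EuclideanSpace.single j 1) :=
    hwave.continuous.mul ((hg.continuous_fderiv one_ne_zero).clm_apply continuous_const)
  have hcont : Continuous fun y => I * ξ j * (wave (-ξ) y * g y) :=
    continuous_const.mul (hwave.continuous.mul hg.continuous)
  simp only [hproduct] at hzero
  rw [integral_sub ((memLp_cell_of_continuous hcont_fderiv 1).integrable le_rfl)
    ((memLp_cell_of_continuous hcont 1).integrable le_rfl), integral_const_mul,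
    sub_eq_zero] at hzero
  simpa only [conj_wave] using hzero

/- The constant `1` is periodic with zero derivative, so integration by parts gives
`i ξ_j ∫ exp(-i ξ · y) = 0`. -/
lemma setIntegral_cell_wave_frequency_zero {k : Fin d → ℤ} (hk : k ≠ 0) :
    ∫ y in cell d, wave (frequency 0 k) y = 0 := by
  obtain ⟨j, hj⟩ := Function.ne_iff.1 hk
  have hparts := setIntegral_cell_conj_wave_mul_fderiv (θ := 0) (g := fun _ => 1)
    contDiff_const (by simp) (-k) j
  have hξ : frequency 0 k j ≠ 0 := by simpa [frequency_apply, Real.pi_ne_zero] using hj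
  simpa [hξ, conj_wave, frequency_zero_neg] using hparts

end IntegrationByParts

section PlaneWave

variable {d : ℕ} {E : Type*} [NormedAddCommGroup E] [InnerProductSpace ℂ E]

lemma memLp_wave_smul (ξ : Pt d) (v : E) : MemLp (fun y => wave ξ y • v) 2 (cellMeasure d) :=
  memLp_cell_of_continuous ((continuous_wave ξ).smul continuous_const) 2

/-- The plane waves `y ↦ exp(i ξ · y) v` in `L²(Y)`, as an isometry in the amplitude `v`. -/
noncomputable def planeWave (ξ : Pt d) : E →ₗᵢ[ℂ] Lp E 2 (cellMeasure d) where
  toFun v := (memLp_wave_smul ξ v).toLp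
  map_add' v w := by
    rw [← MemLp.toLp_add]
    exact MemLp.toLp_congr _ _ (.of_forall fun y => smul_add _ _ _)
  map_smul' c v := by
    rw [RingHom.id_apply, ← MemLp.toLp_const_smul]
    exact MemLp.toLp_congr _ _ (.of_forall fun y => smul_comm _ _ _)
  norm_map' v := by
    change ‖(memLp_wave_smul ξ v).toLp‖ = ‖v‖
    rw [Lp.norm_toLp, eLpNorm_congr_norm_ae (g := fun _ => v)
      (.of_forall fun y => by rw [norm_smul, norm_wave, one_mul]),
      eLpNorm_const v two_ne_zero (NeZero.ne _)]
    simp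

lemma coeFn_planeWave (ξ : Pt d) (v : E) :
    planeWave ξ v =ᵐ[cellMeasure d] fun y => wave ξ y • v :=
  (memLp_wave_smul ξ v).coeFn_toLp

lemma inner_planeWave_planeWave (ξ η : Pt d) (v w : E) :
    inner ℂ (planeWave ξ v) (planeWave η w) = (∫ y in cell d, wave (η - ξ) y) * inner ℂ v w := by
  rw [L2.inner_def, ← integral_mul_const]
  refine integral_congr_ae ?_
  filter_upwards [coeFn_planeWave ξ v, coeFn_planeWave η w] with y hv hw
  rw [hv, hw, inner_smul_left, inner_smul_right, conj_wave, sub_eq_add_neg, wave_add_left]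
  ring

variable [CompleteSpace E]

/-- The Fourier coefficient `∫_Y exp(-i ξ · y) u(y) dy`, defined by duality with `planeWave ξ`. -/
noncomputable def waveCoeff (ξ : Pt d) : Lp E 2 (cellMeasure d) →L[ℂ] E :=
  (planeWave ξ).toContinuousLinearMap.adjoint

lemma inner_waveCoeff_right (ξ : Pt d) (v : E) (u : Lp E 2 (cellMeasure d)) :
    inner ℂ v (waveCoeff ξ u) = inner ℂ (planeWave ξ v) u :=
  ContinuousLinearMap.adjoint_inner_right _ _ _

lemma waveCoeff_planeWave_self (ξ : Pt d) (v : E) : waveCoeff ξ (planeWave ξ v) = v :=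
  ext_inner_left ℂ fun w => by rw [inner_waveCoeff_right, LinearIsometry.inner_map_map]

lemma waveCoeff_planeWave_of_ne {k m : Fin d → ℤ} (hkm : k ≠ m) (θ : Pt d) (v : E) :
    waveCoeff (frequency θ k) (planeWave (frequency θ m) v) = 0 :=
  ext_inner_left ℂ fun w => by
    rw [inner_waveCoeff_right, inner_planeWave_planeWave, frequency_sub_frequency,
      setIntegral_cell_wave_frequency_zero (sub_ne_zero.2 hkm.symm), zero_mul, inner_zero_right]

variable {ι : Type*} [Fintype ι]

lemma waveCoeff_apply (ξ : Pt d) (u : Lp (EuclideanSpace ℂ ι) 2 (cellMeasure d)) (i : ι) :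
    waveCoeff ξ u i = ∫ y in cell d, starRingEnd ℂ (wave ξ y) * u y i := by
  classical
  have hcoord : waveCoeff ξ u i = inner ℂ (EuclideanSpace.single i 1) (waveCoeff ξ u) := by
    simp [EuclideanSpace.inner_single_left]
  rw [hcoord, inner_waveCoeff_right, L2.inner_def]
  refine integral_congr_ae ?_
  filter_upwards [coeFn_planeWave ξ (EuclideanSpace.single i (1 : ℂ))] with y hy
  rw [hy, inner_smul_left, EuclideanSpace.inner_single_left, map_one, one_mul]

end PlaneWave

section Parseval

variable {d : ℕ}

/-- The Haar probability measure, for which Mathlib's `UnitAddTorus.mFourier` is orthonormal. -/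
noncomputable local instance instMeasureSpaceUnitAddCircleHaar : MeasureSpace UnitAddCircle :=
  ⟨AddCircle.haarAddCircle⟩

/-- The section of the quotient map from `ℝ^d` to the torus with values in `(0,1]^d`. -/
noncomputable def torusSection (x : UnitAddTorus (Fin d)) : Pt d :=
  WithLp.toLp 2 (UnitAddTorus.measurableEquivPiIoc (0 : Fin d → ℝ) x).1

lemma measurePreserving_torusSection :
    MeasurePreserving (torusSection (d := d)) volume (cellMeasure d) := by
  let box : Set (Fin d → ℝ) := {x | ∀ i, x i ∈ Set.Ioc ((0 : Fin d → ℝ) i) ((0 : Fin d → ℝ) i + 1)}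
  have hbox : box = Set.univ.pi fun i => Set.Ioc ((0 : Fin d → ℝ) i) ((1 : Fin d → ℝ) i) := by
    ext x; simp [box]
  have hmeas : MeasurableSet box := by
    rw [hbox]; exact MeasurableSet.univ_pi fun _ => measurableSet_Ioc
  have hcoe : MeasurePreserving (Subtype.val : box → Fin d → ℝ) (volume.comap Subtype.val)
      (volume.restrict (Set.univ.pi fun _ => Set.Ioo (0 : ℝ) 1)) := by
    refine ⟨measurable_subtype_coe, (map_comap_subtype_coe hmeas volume).trans ?_⟩
    rw [hbox]
    exact Measure.restrict_congr_set
      (Measure.univ_pi_Ioc_ae_eq_Icc.trans Measure.univ_pi_Ioo_ae_eq_Icc.symm)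
  have htoLp : MeasurePreserving (WithLp.toLp 2 : (Fin d → ℝ) → Pt d)
      (volume.restrict (Set.univ.pi fun _ => Set.Ioo (0 : ℝ) 1)) (cellMeasure d) :=
    measurePreserving_ofLp_cell.symm (MeasurableEquiv.toLp 2 (Fin d → ℝ)).symm
  exact (htoLp.comp hcoe).comp (UnitAddTorus.measurePreserving_equivPiIoc 0)

lemma integral_torusSection {F : Type*} [NormedAddCommGroup F] [NormedSpace ℝ F] {f : Pt d → F}
    (hf : AEStronglyMeasurable f (cellMeasure d)) :
    ∫ x, f (torusSection x) = ∫ y in cell d, f y := by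
  rw [← measurePreserving_torusSection.map_eq] at hf
  rw [← integral_map measurePreserving_torusSection.aemeasurable hf,
    measurePreserving_torusSection.map_eq]

lemma mFourier_eq_wave (k : Fin d → ℤ) (x : UnitAddTorus (Fin d)) :
    UnitAddTorus.mFourier k x = wave (frequency 0 k) (torusSection x) := by
  have hx : x = fun i => ((torusSection x i : ℝ) : UnitAddCircle) :=
    ((UnitAddTorus.measurableEquivPiIoc (0 : Fin d → ℝ)).symm_apply_apply x).symm
  conv_lhs => rw [hx]
  simp only [UnitAddTorus.mFourier, ContinuousMap.coe_mk, fourier_coe_apply, wave, ← exp_sum]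
  push_cast
  rw [Finset.mul_sum]
  refine congrArg cexp (Finset.sum_congr rfl fun j _ => ?_)
  rw [frequency_apply]
  push_cast [PiLp.zero_apply]
  ring

lemma hasSum_norm_sq_integral_wave_zero {f : Pt d → ℂ} (hf : MemLp f 2 (cellMeasure d)) :
    HasSum (fun k => ‖∫ y in cell d, starRingEnd ℂ (wave (frequency 0 k) y) * f y‖ ^ 2)
      (∫ y in cell d, ‖f y‖ ^ 2) := by
  have hF := hf.comp_measurePreserving measurePreserving_torusSection
  convert UnitAddTorus.hasSum_sq_mFourierCoeff hF.toLp using 1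
  · funext k
    have hmeas := (continuous_conj.comp
      (continuous_wave (frequency 0 k))).aestronglyMeasurable.mul hf.1
    refine congrArg (‖·‖ ^ 2) ((integral_torusSection hmeas).symm.trans (integral_congr_ae ?_))
    filter_upwards [hF.coeFn_toLp] with x hx
    rw [hx, UnitAddTorus.mFourier_neg, mFourier_eq_wave]
    rfl
  · refine (integral_torusSection (hf.1.norm.pow 2)).symm.trans (integral_congr_ae ?_)
    filter_upwards [hF.coeFn_toLp] with x hx
    rw [hx]
    rfl

lemma hasSum_norm_sq_integral_wave (θ : Pt d) {f : Pt d → ℂ} (hf : MemLp f 2 (cellMeasure d)) :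
    HasSum (fun k => ‖∫ y in cell d, starRingEnd ℂ (wave (frequency θ k) y) * f y‖ ^ 2)
      (∫ y in cell d, ‖f y‖ ^ 2) := by
  have htwist : MemLp (fun y => wave (-θ) y * f y) 2 (cellMeasure d) :=
    hf.of_le ((continuous_wave _).aestronglyMeasurable.mul hf.1) (.of_forall fun y => by simp)
  have hintegrand : ∀ k y, starRingEnd ℂ (wave (frequency θ k) y) * f y =
      starRingEnd ℂ (wave (frequency 0 k) y) * (wave (-θ) y * f y) := fun k y => by
    rw [frequency_eq_add, wave_add_left, map_mul, conj_wave θ]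
    ring
  simpa only [hintegrand, norm_mul, norm_wave, one_mul] using
    hasSum_norm_sq_integral_wave_zero htwist

variable {ι : Type*} [Fintype ι]

lemma norm_sq_eq_sum_setIntegral (u : Lp (EuclideanSpace ℂ ι) 2 (cellMeasure d)) :
    ‖u‖ ^ 2 = ∑ i, ∫ y in cell d, ‖u y i‖ ^ 2 := by
  have hcoord : ∀ i, MemLp (fun y => u y i) 2 (cellMeasure d) := fun i =>
    (EuclideanSpace.proj i : EuclideanSpace ℂ ι →L[ℂ] ℂ).comp_memLp' (Lp.memLp u)
  rw [← integral_finsetSum _ fun i _ => (hcoord i).integrable_norm_pow two_ne_zero,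
    @norm_sq_eq_re_inner ℂ, L2.inner_def, ← integral_re (L2.integrable_inner u u)]
  simp only [inner_self_eq_norm_sq, EuclideanSpace.norm_sq_eq]

theorem hasSum_norm_sq_waveCoeff (θ : Pt d) (u : Lp (EuclideanSpace ℂ ι) 2 (cellMeasure d)) :
    HasSum (fun k => ‖waveCoeff (frequency θ k) u‖ ^ 2) (‖u‖ ^ 2) := by
  simp only [norm_sq_eq_sum_setIntegral, EuclideanSpace.norm_sq_eq, waveCoeff_apply]
  exact hasSum_sum fun i _ => hasSum_norm_sq_integral_wave θ
    ((EuclideanSpace.proj i : EuclideanSpace ℂ ι →L[ℂ] ℂ).comp_memLp' (Lp.memLp u))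

lemma eq_planeWave_of_waveCoeff_eq_zero {θ : Pt d} {u : Lp (EuclideanSpace ℂ ι) 2 (cellMeasure d)}
    (hu : ∀ k ≠ 0, waveCoeff (frequency θ k) u = 0) : u = planeWave θ (waveCoeff θ u) := by
  have hcoeff : ∀ k, waveCoeff (frequency θ k) (u - planeWave θ (waveCoeff θ u)) = 0 := fun k => by
    obtain rfl | hk := eq_or_ne k 0
    · rw [frequency_zero_right, map_sub, waveCoeff_planeWave_self, sub_self]
    · have hwave := waveCoeff_planeWave_of_ne hk θ (waveCoeff θ u)
      rw [frequency_zero_right] at hwave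
      rw [map_sub, hu k hk, hwave, sub_zero]
  have hsum := hasSum_norm_sq_waveCoeff θ (u - planeWave θ (waveCoeff θ u))
  simp only [hcoeff, norm_zero, ne_eq, OfNat.ofNat_ne_zero, not_false_eq_true, zero_pow] at hsum
  exact sub_eq_zero.1 (norm_eq_zero.1 (sq_eq_zero_iff.1 (hsum.unique hasSum_zero)))

end Parseval

section Gradient

variable {n d : ℕ} {θ : Pt d}

/-- The symbol `v ↦ i v ⊗ ξ` of the gradient: `grad (exp(i ξ · y) v) = exp(i ξ · y) (i v ⊗ ξ)`. -/
noncomputable def gradSymbol (ξ : Pt d) (v : Vec n) : Mat n d :=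
  WithLp.toLp 2 fun p => I * ξ p.2 * v p.1

lemma gradSymbol_apply (ξ : Pt d) (v : Vec n) (p : Fin n × Fin d) :
    gradSymbol ξ v p = I * ξ p.2 * v p.1 :=
  rfl

lemma norm_gradSymbol (ξ : Pt d) (v : Vec n) : ‖gradSymbol ξ v‖ = ‖ξ‖ * ‖v‖ := by
  rw [← sq_eq_sq₀ (norm_nonneg _) (by positivity), mul_pow, EuclideanSpace.norm_sq_eq,
    EuclideanSpace.norm_sq_eq, EuclideanSpace.norm_sq_eq, Finset.sum_mul_sum, Finset.sum_comm,
    Fintype.sum_prod_type]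
  simp [gradSymbol_apply, mul_pow]

lemma gradSymbol_zero_left (v : Vec n) : gradSymbol (0 : Pt d) v = 0 := by
  rw [← norm_eq_zero, norm_gradSymbol, norm_zero, zero_mul]

lemma gradSymbol_zero_right (ξ : Pt d) : gradSymbol ξ (0 : Vec n) = 0 := by
  rw [← norm_eq_zero, norm_gradSymbol, norm_zero, mul_zero]

lemma gradient_apply {φ : Pt d → Vec n} {y : Pt d} (hφ : DifferentiableAt ℝ φ y)
    (p : Fin n × Fin d) :
    gradient φ y p = fderiv ℝ (fun y => φ y p.1) y (EuclideanSpace.single p.2 1) := by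
  have hcoord : HasFDerivAt (fun y => φ y p.1)
      ((EuclideanSpace.proj p.1 : Vec n →L[ℂ] ℂ).restrictScalars ℝ ∘L fderiv ℝ φ y) y :=
    ((EuclideanSpace.proj p.1 : Vec n →L[ℂ] ℂ).restrictScalars ℝ).hasFDerivAt.comp y
      hφ.hasFDerivAt
  rw [hcoord.fderiv]
  rfl

lemma gradient_zero (y : Pt d) : gradient (0 : Pt d → Vec n) y = 0 := by
  ext p
  simp [gradient]

lemma gradient_add {φ ψ : Pt d → Vec n} {y : Pt d} (hφ : DifferentiableAt ℝ φ y)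
    (hψ : DifferentiableAt ℝ ψ y) : gradient (φ + ψ) y = gradient φ y + gradient ψ y := by
  ext p
  simp [gradient, fderiv_add hφ hψ]

lemma gradient_const_smul {φ : Pt d → Vec n} {y : Pt d} (hφ : DifferentiableAt ℝ φ y) (c : ℂ) :
    gradient (c • φ) y = c • gradient φ y := by
  ext p
  simp [gradient, fderiv_const_smul hφ c]

lemma gradient_wave_smul (ξ y : Pt d) (v : Vec n) :
    gradient (fun y => wave ξ y • v) y = wave ξ y • gradSymbol ξ v := by
  have hwave : DifferentiableAt ℝ (wave ξ) y := (contDiff_wave ξ).differentiable (by simp) y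
  ext p
  rw [gradient_apply (hwave.smul_const v)]
  simp only [PiLp.smul_apply, smul_eq_mul, gradSymbol_apply]
  rw [fderiv_mul_const hwave, smul_apply, fderiv_wave, EuclideanSpace.inner_single_right,
    conj_trivial, one_mul, smul_eq_mul]
  ring

lemma SmoothQuasiPeriodic.differentiable {φ : Pt d → Vec n} (hφ : SmoothQuasiPeriodic θ φ) :
    Differentiable ℝ φ :=
  hφ.smooth.differentiable (by simp)

/-- The pairs `(φ, grad φ)`, `φ ∈ [C^∞_θ(Y)]^n`, as a subspace of `L² × L²`. -/
noncomputable def smoothGraph (θ : Pt d) : Submodule ℂ (L2Vec n d × L2Mat n d) where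
  carrier := {p | ∃ φ : Pt d → Vec n, SmoothQuasiPeriodic θ φ ∧
    p.1 =ᵐ[cellMeasure d] φ ∧ p.2 =ᵐ[cellMeasure d] gradient φ}
  zero_mem' := ⟨0, ⟨contDiff_const, by simp⟩, Lp.coeFn_zero _ _ _,
    (Lp.coeFn_zero _ _ _).trans (.of_forall fun y => (gradient_zero y).symm)⟩
  add_mem' := by
    rintro p q ⟨φ, hφ, hpφ, hpgrad⟩ ⟨ψ, hψ, hqψ, hqgrad⟩
    refine ⟨φ + ψ, ⟨hφ.smooth.add hψ.smooth, fun k x => ?_⟩,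
      (Lp.coeFn_add _ _).trans (hpφ.add hqψ), (Lp.coeFn_add _ _).trans
        ((hpgrad.add hqgrad).trans (.of_forall fun y =>
          (gradient_add (hφ.differentiable y) (hψ.differentiable y)).symm))⟩
    simp only [Pi.add_apply, hφ.quasiPeriodic, hψ.quasiPeriodic, smul_add]
  smul_mem' := by
    rintro c p ⟨φ, hφ, hpφ, hpgrad⟩
    refine ⟨c • φ, ⟨contDiff_const.smul hφ.smooth, fun k x => ?_⟩,
      (Lp.coeFn_smul _ _).trans (hpφ.const_smul c), (Lp.coeFn_smul _ _).trans
        ((hpgrad.const_smul c).trans (.of_forall fun y =>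
          (gradient_const_smul (hφ.differentiable y) c).symm))⟩
    simp only [Pi.smul_apply, hφ.quasiPeriodic, smul_comm c]

lemma planeWave_mem_gradGraph (θ : Pt d) (k : Fin d → ℤ) (v : Vec n) :
    (planeWave (frequency θ k) v, planeWave (frequency θ k) (gradSymbol (frequency θ k) v)) ∈
      gradGraph θ := by
  refine subset_closure ⟨fun y => wave (frequency θ k) y • v,
    ⟨(contDiff_wave _).smul contDiff_const, fun m x => ?_⟩, coeFn_planeWave _ _,
    (coeFn_planeWave _ _).trans (.of_forall fun y => (gradient_wave_smul _ y v).symm)⟩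
  rw [wave_add_right, wave_frequency_latticePt, mul_comm, mul_smul]

lemma waveCoeff_gradient {φ : Pt d → Vec n} (hφ : SmoothQuasiPeriodic θ φ)
    {p : L2Vec n d × L2Mat n d} (hp : p.1 =ᵐ[cellMeasure d] φ)
    (hgrad : p.2 =ᵐ[cellMeasure d] gradient φ) (k : Fin d → ℤ) :
    waveCoeff (frequency θ k) p.2 =
      gradSymbol (frequency θ k) (waveCoeff (frequency θ k) p.1) := by
  ext ⟨i, j⟩
  have hsmooth : ContDiff ℝ ∞ fun y => φ y i :=
    ((EuclideanSpace.proj i : Vec n →L[ℂ] ℂ).restrictScalars ℝ).contDiff.comp hφ.smooth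
  have hparts := setIntegral_cell_conj_wave_mul_fderiv (θ := θ) (g := fun y => φ y i)
    (hsmooth.of_le (by norm_cast)) (fun m x => by simp [hφ.quasiPeriodic]) k j
  have hfst : waveCoeff (frequency θ k) p.1 i =
      ∫ y in cell d, starRingEnd ℂ (wave (frequency θ k) y) * φ y i := by
    rw [waveCoeff_apply]
    refine integral_congr_ae ?_
    filter_upwards [hp] with y hy
    rw [hy]
  rw [gradSymbol_apply, waveCoeff_apply, hfst, ← hparts]
  refine integral_congr_ae ?_
  filter_upwards [hgrad] with y hy
  rw [hy, gradient_apply (hφ.differentiable y)]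

lemma continuous_gradSymbol (ξ : Pt d) : Continuous (gradSymbol (n := n) ξ) :=
  (PiLp.continuous_toLp 2 _).comp (by fun_prop)

lemma waveCoeff_snd_of_mem_gradGraph {p : L2Vec n d × L2Mat n d} (hp : p ∈ gradGraph θ)
    (k : Fin d → ℤ) :
    waveCoeff (frequency θ k) p.2 =
      gradSymbol (frequency θ k) (waveCoeff (frequency θ k) p.1) := by
  have hclosed : IsClosed {p : L2Vec n d × L2Mat n d | waveCoeff (frequency θ k) p.2 =
      gradSymbol (frequency θ k) (waveCoeff (frequency θ k) p.1)} :=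
    isClosed_eq ((waveCoeff _).continuous.comp continuous_snd)
      ((continuous_gradSymbol _).comp ((waveCoeff _).continuous.comp continuous_fst))
  refine closure_minimal ?_ hclosed hp
  rintro q ⟨φ, hφ, hqφ, hqgrad⟩
  exact waveCoeff_gradient hφ hqφ hqgrad k

lemma orthWave_iff_waveCoeff_eq_zero {u : L2Vec n d} : OrthWave θ u ↔ waveCoeff θ u = 0 := by
  simp only [OrthWave, ← waveCoeff_apply, PiLp.ext_iff, PiLp.zero_apply]

lemma pi_le_norm_frequency (hθ : θ ∈ quasimomenta d) {k : Fin d → ℤ} (hk : k ≠ 0) :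
    Real.pi ≤ ‖frequency θ k‖ := by
  obtain ⟨j, hj⟩ := Function.ne_iff.1 hk
  have hk_abs : (1 : ℝ) ≤ |(k j : ℝ)| := by exact_mod_cast Int.one_le_abs hj
  calc Real.pi ≤ 2 * Real.pi * |(k j : ℝ)| - |θ j| := by
        nlinarith [Real.pi_pos, abs_le.2 ⟨(hθ j).1, (hθ j).2.le⟩]
    _ ≤ |frequency θ k j| := by
        rw [frequency_apply, ← abs_of_pos Real.two_pi_pos, ← abs_mul, abs_of_pos Real.two_pi_pos,
          add_comm]
        simpa using abs_sub_abs_le_abs_sub (2 * Real.pi * k j) (-θ j)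
    _ ≤ ‖frequency θ k‖ := (Real.norm_eq_abs _).symm.trans_le (PiLp.norm_apply_le _ j)

theorem pi_mul_norm_le_norm_gradient (hθ : θ ∈ quasimomenta d) {p : L2Vec n d × L2Mat n d}
    (hp : p ∈ gradGraph θ) (horth : OrthWave θ p.1) : Real.pi * ‖p.1‖ ≤ ‖p.2‖ := by
  refine le_of_sq_le_sq ?_ (norm_nonneg _)
  rw [mul_pow]
  refine hasSum_le (fun k => ?_) ((hasSum_norm_sq_waveCoeff θ p.1).mul_left _)
    (hasSum_norm_sq_waveCoeff θ p.2)
  rw [waveCoeff_snd_of_mem_gradGraph hp, norm_gradSymbol, ← mul_pow]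
  obtain rfl | hk := eq_or_ne k 0
  · simp [orthWave_iff_waveCoeff_eq_zero.1 horth]
  · have := Real.pi_pos
    gcongr
    exact pi_le_norm_frequency hθ hk

/-- The graph of the restriction of `grad_θ` to the orthogonal complement of `exp(i θ · y)`. -/
noncomputable def orthGraph (θ : Pt d) : Submodule ℂ (L2Vec n d × L2Mat n d) :=
  (smoothGraph θ).topologicalClosure ⊓
    (waveCoeff θ ∘L ContinuousLinearMap.fst ℂ (L2Vec n d) (L2Mat n d)).ker

lemma mem_orthGraph {p : L2Vec n d × L2Mat n d} :
    p ∈ orthGraph θ ↔ p ∈ gradGraph θ ∧ OrthWave θ p.1 := by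
  rw [orthWave_iff_waveCoeff_eq_zero]
  rfl

lemma planeWave_mem_orthGraph (θ : Pt d) {k : Fin d → ℤ} (hk : k ≠ 0) (v : Vec n) :
    (planeWave (frequency θ k) v, planeWave (frequency θ k) (gradSymbol (frequency θ k) v)) ∈
      orthGraph θ := by
  refine mem_orthGraph.2 ⟨planeWave_mem_gradGraph θ k v, orthWave_iff_waveCoeff_eq_zero.2 ?_⟩
  simpa only [frequency_zero_right] using waveCoeff_planeWave_of_ne hk.symm θ v

instance (θ : Pt d) : CompleteSpace (orthGraph (n := n) θ) :=
  ((Submodule.isClosed_topologicalClosure _).inter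
    (ContinuousLinearMap.isClosed_ker _)).completeSpace_coe

lemma antilipschitzWith_snd_orthGraph (hθ : θ ∈ quasimomenta d) :
    AntilipschitzWith 1 fun p : orthGraph (n := n) θ => p.1.2 := by
  refine (ContinuousLinearMap.snd ℂ (L2Vec n d) (L2Mat n d) ∘L
    (orthGraph θ).subtypeL).antilipschitz_of_bound fun p => ?_
  obtain ⟨hp, horth⟩ := mem_orthGraph.1 p.2
  rw [NNReal.coe_one, one_mul]
  refine max_le ?_ le_rfl
  calc ‖p.1.1‖ ≤ Real.pi * ‖p.1.1‖ :=
        le_mul_of_one_le_left (norm_nonneg _) (by linarith [Real.two_le_pi])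
    _ ≤ ‖p.1.2‖ := pi_mul_norm_le_norm_gradient hθ hp horth

/-- The range of `grad_θ` on the orthogonal complement of `exp(i θ · y)`. -/
noncomputable def gradRange (θ : Pt d) : Submodule ℂ (L2Mat n d) :=
  (orthGraph θ).map (LinearMap.snd ℂ (L2Vec n d) (L2Mat n d))

lemma isClosed_gradRange (hθ : θ ∈ quasimomenta d) :
    IsClosed (gradRange (n := n) θ : Set (L2Mat n d)) := by
  convert (antilipschitzWith_snd_orthGraph hθ).isClosed_range
    (ContinuousLinearMap.snd ℂ (L2Vec n d) (L2Mat n d) ∘L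
      (orthGraph θ).subtypeL).uniformContinuous
  ext q
  simp [gradRange]

end Gradient

section CellProblem

variable {n d : ℕ} {a : Pt d → Tensor n d} {θ : Pt d} {r : Fin n} {s : Fin d}

lemma planeWave_mem_orthogonal_gradRange (θ : Pt d) (V : Mat n d) :
    planeWave θ V ∈ (gradRange θ)ᗮ := by
  rintro _ ⟨p, hp, rfl⟩
  obtain ⟨hp, horth⟩ := mem_orthGraph.1 hp
  have hcoeff := waveCoeff_snd_of_mem_gradGraph hp 0
  rw [frequency_zero_right, orthWave_iff_waveCoeff_eq_zero.1 horth, gradSymbol_zero_right] at hcoeff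
  rw [LinearMap.snd_apply, ← inner_conj_symm, ← inner_waveCoeff_right, hcoeff, inner_zero_right,
    map_zero]

lemma PeriodicCoercive.memLp_cell (ha : PeriodicCoercive a) : MemLp a ⊤ (cellMeasure d) :=
  ha.memLp.restrict _

lemma PeriodicCoercive.isCoerciveOperator_mulOp (ha : PeriodicCoercive a) :
    IsCoerciveOperator (mulOp ha.memLp_cell) := by
  obtain ⟨ν, hν, hbound⟩ := ha.coercive
  exact FibreHom.isCoerciveOperator_mulOp ha.memLp_cell hν (ae_restrict_of_ae hbound)

lemma isCellSolution_iff (ha : MemLp a ⊤ (cellMeasure d)) {p : L2Vec n d × L2Mat n d} :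
    IsCellSolution a θ r s p ↔
      p ∈ orthGraph θ ∧ mulOp ha (p.2 + planeWave θ (matUnit r s)) ∈ (gradRange θ)ᗮ := by
  have hinner : ∀ G : L2Mat n d, inner ℂ G (mulOp ha (p.2 + planeWave θ (matUnit r s))) =
      ∫ y in cell d, inner ℂ (G y) (a y (p.2 y + wave θ y • matUnit r s)) := fun G => by
    rw [L2.inner_def]
    refine integral_congr_ae ?_
    filter_upwards [coeFn_mulOp ha (p.2 + planeWave θ (matUnit r s)),
      Lp.coeFn_add p.2 (planeWave θ (matUnit r s)),
      coeFn_planeWave θ (matUnit r s)] with y hmul hadd hwave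
    rw [hmul, hadd, Pi.add_apply, hwave]
  rw [mem_orthGraph]
  constructor
  · rintro ⟨hp, horth, hzero⟩
    refine ⟨⟨hp, horth⟩, ?_⟩
    rintro _ ⟨t, ht, rfl⟩
    exact (hinner t.2).trans (hzero t (mem_orthGraph.1 ht).1 (mem_orthGraph.1 ht).2)
  · rintro ⟨⟨hp, horth⟩, hperp⟩
    exact ⟨hp, horth, fun t ht htorth =>
      (hinner t.2).symm.trans (hperp t.2 ⟨t, mem_orthGraph.2 ⟨ht, htorth⟩, rfl⟩)⟩

lemma isCellSolution_zero_iff (ha : MemLp a ⊤ (cellMeasure d)) :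
    IsCellSolution a θ r s 0 ↔ mulOp ha (planeWave θ (matUnit r s)) ∈ (gradRange θ)ᗮ := by
  rw [isCellSolution_iff ha, Prod.snd_zero, zero_add, and_iff_right (zero_mem _)]

theorem existsUnique_isCellSolution (ha : PeriodicCoercive a) (hθ : θ ∈ quasimomenta d)
    (r : Fin n) (s : Fin d) : ∃! p, IsCellSolution a θ r s p := by
  have : CompleteSpace (gradRange (n := n) θ) := (isClosed_gradRange hθ).completeSpace_coe
  obtain ⟨w, ⟨⟨p, hp, hpw⟩, hw⟩, hunique⟩ :=
    ha.isCoerciveOperator_mulOp.existsUnique_map_add_mem_orthogonal (gradRange θ)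
      (planeWave θ (matUnit r s))
  subst hpw
  refine ⟨p, (isCellSolution_iff ha.memLp_cell).2 ⟨hp, hw⟩, fun q hq => ?_⟩
  obtain ⟨hq, hqw⟩ := (isCellSolution_iff ha.memLp_cell).1 hq
  exact congrArg Subtype.val ((antilipschitzWith_snd_orthGraph hθ).injective
    (a₁ := ⟨q, hq⟩) (a₂ := ⟨p, hp⟩) (hunique q.2 ⟨⟨q, hq, rfl⟩, hqw⟩))

lemma IsCellSolution.cellSolution_eq (ha : PeriodicCoercive a) (hθ : θ ∈ quasimomenta d)
    {p : L2Vec n d × L2Mat n d} (hp : IsCellSolution a θ r s p) : cellSolution a θ r s = p :=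
  (existsUnique_isCellSolution ha hθ r s).unique (Classical.epsilon_spec ⟨p, hp⟩) hp

end CellProblem

section HomogenisedTensor

variable {n d : ℕ} {a : Pt d → Tensor n d} {θ : Pt d} {r : Fin n} {s : Fin d}

lemma sum_component_mul (A : Tensor n d) (i : Fin n) (j : Fin d) (X : Mat n d) :
    ∑ k, ∑ l, component A i j k l * X (k, l) = inner ℂ (matUnit i j) (A X) := by
  have hX : X = ∑ p : Fin n × Fin d, X p • matUnit p.1 p.2 := by
    ext q
    simp [matUnit, Pi.single_apply]
  conv_rhs => rw [hX, map_sum, inner_sum, Fintype.sum_prod_type]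
  refine Finset.sum_congr rfl fun k _ => Finset.sum_congr rfl fun l _ => ?_
  rw [map_smul, inner_smul_right, component, mul_comm]

lemma integrable_component_mul (ha : MemLp a ⊤ (cellMeasure d)) (Z : L2Mat n d) (i : Fin n)
    (j : Fin d) (k : Fin n) (l : Fin d) :
    Integrable (fun y => component (a y) i j k l * Z y (k, l) * wave (-θ) y) (cellMeasure d) := by
  have hcomponent : MemLp (fun y => component (a y) i j k l) ⊤ (cellMeasure d) :=
    (innerSL ℂ (matUnit i j) ∘L ContinuousLinearMap.apply ℂ (Mat n d) (matUnit k l)).comp_memLp' ha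
  have hcoord : MemLp (fun y => Z y (k, l)) 2 (cellMeasure d) :=
    (EuclideanSpace.proj (k, l) : Mat n d →L[ℂ] ℂ).comp_memLp' (Lp.memLp Z)
  have hwave : MemLp (wave (-θ)) ⊤ (cellMeasure d) :=
    memLp_cell_of_continuous (continuous_wave _) _
  exact (hwave.mul (r := 2) (hcoord.mul (r := 2) hcomponent)).integrable one_le_two

lemma sum_integral_component_mul (ha : MemLp a ⊤ (cellMeasure d)) (Z : L2Mat n d) (i : Fin n)
    (j : Fin d) :
    ∑ k, ∑ l, ∫ y in cell d, component (a y) i j k l * Z y (k, l) * wave (-θ) y =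
      inner ℂ (planeWave θ (matUnit i j)) (mulOp ha Z) := by
  simp_rw [← integral_finsetSum _ fun l _ => integrable_component_mul ha Z i j _ l]
  rw [← integral_finsetSum _ fun k _ => integrable_finsetSum _ fun l _ =>
    integrable_component_mul ha Z i j k l, L2.inner_def]
  refine integral_congr_ae ?_
  filter_upwards [coeFn_mulOp ha Z, coeFn_planeWave θ (matUnit i j)] with y hmul hwave
  simp only [← Finset.sum_mul]
  rw [hmul, hwave, sum_component_mul, inner_smul_left, conj_wave, mul_comm]

theorem IsCellSolution.aHom_eq_inner (ha : PeriodicCoercive a) (hθ : θ ∈ quasimomenta d)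
    {p : L2Vec n d × L2Mat n d} (hp : IsCellSolution a θ r s p) (i : Fin n) (j : Fin d) :
    aHom a θ i j r s = inner ℂ (planeWave θ (matUnit i j))
      (mulOp ha.memLp_cell (p.2 + planeWave θ (matUnit r s))) := by
  rw [aHom, hp.cellSolution_eq ha hθ, ← sum_integral_component_mul]
  refine Finset.sum_congr rfl fun k _ => Finset.sum_congr rfl fun l _ => integral_congr_ae ?_
  filter_upwards [Lp.coeFn_add p.2 (planeWave θ (matUnit r s)),
    coeFn_planeWave θ (matUnit r s : Mat n d)] with y hadd hwave
  rw [hadd, Pi.add_apply, hwave]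
  by_cases hk : k = r <;> by_cases hl : l = s <;> simp [matUnit, hk, hl]

/-- The Fourier coefficient `∫_Y exp(-2π i k · y) a(y) dy` of the tensor field `a`. -/
noncomputable def tensorCoeff (ha : MemLp a ⊤ (cellMeasure d)) (k : Fin d → ℤ) : Tensor n d :=
  waveCoeff (frequency 0 k) ∘L mulOp ha ∘L (planeWave 0).toContinuousLinearMap

lemma waveCoeff_mulOp_planeWave (ha : MemLp a ⊤ (cellMeasure d)) (θ : Pt d) (k : Fin d → ℤ)
    (X : Mat n d) :
    waveCoeff (frequency θ k) (mulOp ha (planeWave θ X)) = tensorCoeff ha k X := by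
  have hinner : ∀ (θ : Pt d) (V : Mat n d),
      inner ℂ V (waveCoeff (frequency θ k) (mulOp ha (planeWave θ X))) =
        ∫ y in cell d, wave (-frequency 0 k) y * inner ℂ V (a y X) := fun θ V => by
    rw [inner_waveCoeff_right, L2.inner_def]
    refine integral_congr_ae ?_
    filter_upwards [coeFn_mulOp ha (planeWave θ X), coeFn_planeWave θ X,
      coeFn_planeWave (frequency θ k) V] with y hmul hX hV
    rw [hmul, hX, hV, map_smul, inner_smul_left, inner_smul_right, conj_wave, frequency_eq_add,
      neg_add, wave_add_left]
    linear_combination (wave (-frequency 0 k) y * inner ℂ V (a y X)) * wave_mul_wave_neg θ y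
  exact ext_inner_left ℂ fun V => (hinner θ V).trans (hinner 0 V).symm

lemma inner_planeWave_mulOp_planeWave (ha : MemLp a ⊤ (cellMeasure d)) (θ : Pt d) (k : Fin d → ℤ)
    (V X : Mat n d) :
    inner ℂ (planeWave (frequency θ k) V) (mulOp ha (planeWave θ X)) =
      inner ℂ V (tensorCoeff ha k X) := by
  rw [← inner_waveCoeff_right, waveCoeff_mulOp_planeWave]

lemma IsCellSolution.aHom_eq_component (ha : PeriodicCoercive a) (hθ : θ ∈ quasimomenta d)
    (hzero : IsCellSolution a θ r s 0) (i : Fin n) (j : Fin d) :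
    aHom a θ i j r s = component (tensorCoeff ha.memLp_cell 0) i j r s := by
  rw [hzero.aHom_eq_inner ha hθ, Prod.snd_zero, zero_add, component,
    ← inner_planeWave_mulOp_planeWave ha.memLp_cell θ, frequency_zero_right]

end HomogenisedTensor

section Rigidity

variable {n d : ℕ} {a : Pt d → Tensor n d} {θ : Pt d} {r : Fin n} {s : Fin d}

lemma zero_mem_quasimomenta : (0 : Pt d) ∈ quasimomenta d := fun _ => by
  simp [Real.pi_pos, Real.pi_pos.le]

lemma single_mem_quasimomenta (j : Fin d) :
    (EuclideanSpace.single j 1 : Pt d) ∈ quasimomenta d := fun l => by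
  have := Real.two_le_pi
  rw [PiLp.single_apply]
  split_ifs <;> constructor <;> linarith

lemma IsConstant.isCellSolution_zero (hconst : IsConstant a) (ha : MemLp a ⊤ (cellMeasure d))
    (θ : Pt d) (r : Fin n) (s : Fin d) : IsCellSolution a θ r s 0 := by
  obtain ⟨A, hA⟩ := hconst
  have hwave : mulOp ha (planeWave θ (matUnit r s)) = planeWave θ (A (matUnit r s)) := by
    refine Lp.ext ?_
    filter_upwards [coeFn_mulOp ha (planeWave θ (matUnit r s)), ae_restrict_of_ae hA,
      coeFn_planeWave θ (matUnit r s : Mat n d),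
      coeFn_planeWave θ (A (matUnit r s))] with y hmul hy hX hAX
    rw [hmul, hX, hAX, hy, map_smul]
  rw [isCellSolution_zero_iff ha, hwave]
  exact planeWave_mem_orthogonal_gradRange θ _

lemma SelfAdjointDivFree.isCellSolution_zero (ha : SelfAdjointDivFree a) (r : Fin n)
    (s : Fin d) : IsCellSolution a 0 r s 0 := by
  have hmem := ha.periodicCoercive.memLp_cell
  obtain ⟨q, hq, hqa⟩ := ha.divFree (matUnit r s)
  have hmul : mulOp hmem (planeWave 0 (matUnit r s)) = q := by
    refine Lp.ext ?_
    filter_upwards [coeFn_mulOp hmem (planeWave 0 (matUnit r s)), hqa,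
      coeFn_planeWave (0 : Pt d) (matUnit r s : Mat n d)] with y hmul hqy hX
    rw [hmul, hqy, hX, wave_zero_left, one_smul]
  rw [isCellSolution_zero_iff hmem, hmul]
  rintro _ ⟨p, hp, rfl⟩
  rw [LinearMap.snd_apply, hq p (mem_orthGraph.1 hp).1, inner_zero_right, neg_zero]

lemma SelfAdjointDivFree.isCellSolution_zero_of_aHom_eq (ha : SelfAdjointDivFree a)
    (hθ : θ ∈ quasimomenta d) (hdiag : aHom a θ r s r s = aHom a 0 r s r s) :
    IsCellSolution a θ r s 0 := by
  have hcoe := ha.periodicCoercive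
  have hsymm : ∀ᵐ y ∂cellMeasure d, (a y : Mat n d →ₗ[ℂ] Mat n d).IsSymmetric := by
    filter_upwards [ae_restrict_of_ae ha.selfAdjoint] with y hy
    exact ContinuousLinearMap.isSelfAdjoint_iff_isSymmetric.1 hy
  obtain ⟨p, hp, -⟩ := existsUnique_isCellSolution hcoe hθ r s
  rw [hp.aHom_eq_inner hcoe hθ, (ha.isCellSolution_zero r s).aHom_eq_component hcoe
    zero_mem_quasimomenta, component, ← inner_planeWave_mulOp_planeWave _ θ,
    frequency_zero_right] at hdiag
  obtain ⟨hporth, hperp⟩ := (isCellSolution_iff hcoe.memLp_cell).1 hp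
  have hsnd : p.2 = 0 := hcoe.isCoerciveOperator_mulOp.eq_zero_of_inner_map_add_eq
    (isSymmetric_mulOp hcoe.memLp_cell hsymm) (Submodule.mem_map_of_mem hporth) hperp hdiag
  rw [isCellSolution_zero_iff hcoe.memLp_cell]
  rwa [hsnd, zero_add] at hperp

lemma gradSymbol_frequency_single (j : Fin d) (k : Fin d → ℤ) (i : Fin n) :
    gradSymbol (frequency (EuclideanSpace.single j 1) k) (EuclideanSpace.single i 1) =
      I • matUnit i j + gradSymbol (frequency 0 k) (EuclideanSpace.single i 1) := by
  ext ⟨i', l⟩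
  by_cases hi : i' = i <;> by_cases hl : l = j <;>
    simp [gradSymbol_apply, frequency_apply, matUnit, hi, hl, mul_add]

lemma IsCellSolution.inner_gradSymbol_tensorCoeff (ha : MemLp a ⊤ (cellMeasure d))
    (hzero : IsCellSolution a θ r s 0) {k : Fin d → ℤ} (hk : k ≠ 0) (v : Vec n) :
    inner ℂ (gradSymbol (frequency θ k) v) (tensorCoeff ha k (matUnit r s)) = 0 := by
  rw [← inner_planeWave_mulOp_planeWave ha θ]
  exact (isCellSolution_zero_iff ha).1 hzero _
    (Submodule.mem_map_of_mem (planeWave_mem_orthGraph θ hk v))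

lemma tensor_ext {A B : Tensor n d} (h : ∀ i j, A (matUnit i j) = B (matUnit i j)) : A = B :=
  ContinuousLinearMap.coe_injective
    ((EuclideanSpace.basisFun (Fin n × Fin d) ℂ).toBasis.ext fun p => by
      simpa [matUnit] using h p.1 p.2)

/- The symbols of `grad_θ` at `θ = e_j` and at `θ = 0` differ by `i v ⊗ e_j`, so orthogonality to
both of them forces the coefficient to vanish. -/
lemma tensorCoeff_eq_zero (ha : MemLp a ⊤ (cellMeasure d))
    (hzero : ∀ r s, IsCellSolution a 0 r s 0)
    (hsingle : ∀ j r s, IsCellSolution a (EuclideanSpace.single j 1) r s 0) {k : Fin d → ℤ}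
    (hk : k ≠ 0) : tensorCoeff ha k = 0 := by
  refine tensor_ext fun r s => PiLp.ext fun ⟨i, j⟩ => ?_
  have hperp := (hsingle j r s).inner_gradSymbol_tensorCoeff ha hk (EuclideanSpace.single i 1)
  rw [gradSymbol_frequency_single, inner_add_left,
    (hzero r s).inner_gradSymbol_tensorCoeff ha hk, add_zero, inner_smul_left, conj_I,
    neg_mul, neg_eq_zero, mul_eq_zero, or_iff_right I_ne_zero] at hperp
  simpa [matUnit, EuclideanSpace.inner_single_left] using hperp

lemma ae_eq_tensorCoeff_zero (ha : MemLp a ⊤ (cellMeasure d))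
    (hcoeff : ∀ k ≠ 0, tensorCoeff ha k = 0) :
    ∀ᵐ y ∂cellMeasure d, a y = tensorCoeff ha 0 := by
  have hcolumn : ∀ r s, ∀ᵐ y ∂cellMeasure d, a y (matUnit r s) =
      tensorCoeff ha 0 (matUnit r s) := fun r s => by
    have hwave := eq_planeWave_of_waveCoeff_eq_zero (θ := 0)
      (u := mulOp ha (planeWave 0 (matUnit r s))) fun k hk => by
        rw [waveCoeff_mulOp_planeWave, hcoeff k hk, zero_apply]
    have hmean := waveCoeff_mulOp_planeWave ha 0 0 (matUnit r s)
    rw [frequency_zero_right] at hmean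
    rw [hmean] at hwave
    filter_upwards [coeFn_mulOp ha (planeWave 0 (matUnit r s)),
      coeFn_planeWave (0 : Pt d) (matUnit r s : Mat n d),
      coeFn_planeWave (0 : Pt d) (tensorCoeff ha 0 (matUnit r s))] with y hmul hX hA
    rw [hwave, hA, hX, wave_zero_left, one_smul, one_smul] at hmul
    exact hmul.symm
  filter_upwards [ae_all_iff.2 fun r => ae_all_iff.2 (hcolumn r)] with y hy
  exact tensor_ext hy

lemma ae_eq_const_of_ae_cell {β : Type*} {f : Pt d → β} {c : β}
    (hperiodic : ∀ k : Fin d → ℤ, ∀ᵐ x : Pt d, f (x + latticePt k) = f x)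
    (hcell : ∀ᵐ y ∂cellMeasure d, f y = c) : ∀ᵐ x : Pt d, f x = c := by
  let box : Set (Pt d) := (WithLp.ofLp : Pt d → Fin d → ℝ) ⁻¹' Set.univ.pi fun _ => Set.Ico 0 1
  have hbox_ae : box =ᵐ[volume] cell d := by
    rw [cell_eq_preimage]
    refine (PiLp.volume_preserving_ofLp (Fin d)).quasiMeasurePreserving.preimage_ae_eq ?_
    exact (Measure.univ_pi_Ico_ae_eq_Icc (f := 0) (g := 1)).trans
      (Measure.univ_pi_Ioo_ae_eq_Icc (f := 0) (g := 1)).symm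
  have hbox : ∀ᵐ y : Pt d, y ∈ box → f y = c := by
    filter_upwards [(ae_restrict_iff' measurableSet_cell).1 hcell, hbox_ae.mem_iff]
      with y hy hiff hmem
    exact hy (hiff.1 hmem)
  have htranslate : ∀ᵐ x : Pt d, ∀ k : Fin d → ℤ, (x - latticePt k ∈ box →
      f (x - latticePt k) = c) ∧ f (x - latticePt k + latticePt k) = f (x - latticePt k) :=
    ae_all_iff.2 fun k => (measurePreserving_sub_right volume
      (latticePt k)).quasiMeasurePreserving.ae (hbox.and (hperiodic k))
  filter_upwards [htranslate] with x hx
  obtain ⟨hmem, htrans⟩ := hx fun j => ⌊x j⌋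
  rw [sub_add_cancel] at htrans
  rw [htrans]
  exact hmem fun j _ => ⟨Int.fract_nonneg (x j), Int.fract_lt_one (x j)⟩

theorem SelfAdjointDivFree.isConstant_of_aHom_single_eq (ha : SelfAdjointDivFree a)
    (hdiag : ∀ j r s, aHom a (EuclideanSpace.single j 1) r s r s = aHom a 0 r s r s) :
    IsConstant a := by
  have hmem := ha.periodicCoercive.memLp_cell
  refine ⟨tensorCoeff hmem 0, ae_eq_const_of_ae_cell ha.periodicCoercive.periodic
    (ae_eq_tensorCoeff_zero hmem fun k hk => ?_)⟩
  exact tensorCoeff_eq_zero hmem ha.isCellSolution_zero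
    (fun j r s => ha.isCellSolution_zero_of_aHom_eq (single_mem_quasimomenta j) (hdiag j r s)) hk

theorem SelfAdjointDivFree.aHom_eq_iff_isConstant (ha : SelfAdjointDivFree a) :
    (∀ θ ∈ quasimomenta d, θ ≠ 0 → aHom a θ = aHom a 0) ↔ IsConstant a := by
  have hcoe := ha.periodicCoercive
  refine ⟨fun heq => ha.isConstant_of_aHom_single_eq fun j r s => ?_, fun hconst θ hθ _ => ?_⟩
  · rw [heq _ (single_mem_quasimomenta j) (by simp)]
  · funext i j r s
    have hzero := hconst.isCellSolution_zero hcoe.memLp_cell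
    rw [(hzero θ r s).aHom_eq_component hcoe hθ,
      (hzero 0 r s).aHom_eq_component hcoe zero_mem_quasimomenta]

end Rigidity

section Laminate

variable {n d : ℕ} {r : Fin n} {l j : Fin d}

/-- The laminate `y ↦ 1 + ½ cos(2π y_l) P`, where `P` is the orthogonal projection onto the span of
`e_r ⊗ e_j`.  If `l ≠ j`, then `y ↦ laminate r l j y X` is divergence free, as its only nonconstant
entry, the one at `(r, j)`, does not depend on `y_j`. -/
noncomputable def laminate (r : Fin n) (l j : Fin d) (y : Pt d) : Tensor n d :=
  1 + ((Real.cos (2 * Real.pi * y l) / 2 : ℝ) : ℂ) • (ℂ ∙ matUnit r j).starProjection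

lemma laminate_apply (r : Fin n) (l j : Fin d) (y : Pt d) (X : Mat n d) :
    laminate r l j y X = X + ((Real.cos (2 * Real.pi * y l) / 2 : ℝ) : ℂ) •
      (ℂ ∙ matUnit r j).starProjection X := by
  simp [laminate]

lemma continuous_laminate (r : Fin n) (l j : Fin d) : Continuous (laminate r l j) := by
  unfold laminate
  fun_prop

lemma abs_cos_div_two_le (x : ℝ) : |Real.cos x / 2| ≤ 1 / 2 := by
  rw [abs_div, abs_two]
  linarith [Real.abs_cos_le_one x]

lemma memLp_laminate (r : Fin n) (l j : Fin d) : MemLp (laminate r l j) ⊤ volume := by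
  refine memLp_top_of_bound (continuous_laminate r l j).aestronglyMeasurable
    (‖(1 : Tensor n d)‖ + 1 / 2 * ‖(ℂ ∙ matUnit r j).starProjection‖)
    (.of_forall fun y => (norm_add_le _ _).trans ?_)
  rw [norm_smul, Complex.norm_real, Real.norm_eq_abs]
  gcongr
  exact abs_cos_div_two_le _

lemma half_mul_norm_sq_le_re_inner_laminate (r : Fin n) (l j : Fin d) (y : Pt d) (X : Mat n d) :
    1 / 2 * ‖X‖ ^ 2 ≤ (inner ℂ X (laminate r l j y X)).re := by
  set P := (ℂ ∙ matUnit r j).starProjection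
  set c := Real.cos (2 * Real.pi * y l) / 2
  have hproj : (inner ℂ X (P X)).re = ‖P X‖ ^ 2 := by
    rw [← inner_conj_symm, conj_re]
    exact Submodule.re_inner_starProjection_eq_normSq (ℂ ∙ matUnit r j) X
  have hcontract : ‖P X‖ ^ 2 ≤ ‖X‖ ^ 2 := by
    gcongr
    exact Submodule.norm_starProjection_apply_le (ℂ ∙ matUnit r j) X
  have hc : -(1 / 2) ≤ c := (abs_le.1 (abs_cos_div_two_le _)).1
  calc 1 / 2 * ‖X‖ ^ 2 ≤ ‖X‖ ^ 2 + c * ‖P X‖ ^ 2 := by nlinarith [sq_nonneg ‖P X‖]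
    _ = (inner ℂ X (laminate r l j y X)).re := by
      rw [laminate_apply, inner_add_right, inner_smul_right, add_re, re_ofReal_mul, hproj,
        @norm_sq_eq_re_inner ℂ _ _ _ _ X]
      rfl

lemma periodicCoercive_laminate (r : Fin n) (l j : Fin d) : PeriodicCoercive (laminate r l j) where
  memLp := memLp_laminate r l j
  periodic k := .of_forall fun x => by
    have hphase : 2 * Real.pi * (x + latticePt k) l = 2 * Real.pi * x l + k l * (2 * Real.pi) := by
      simp only [latticePt, PiLp.add_apply]
      ring
    rw [laminate, hphase, Real.cos_add_int_mul_two_pi, laminate]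
  coercive := ⟨1 / 2, by norm_num, .of_forall (half_mul_norm_sq_le_re_inner_laminate r l j)⟩

lemma isSelfAdjoint_laminate (r : Fin n) (l j : Fin d) (y : Pt d) :
    IsSelfAdjoint (laminate r l j y) := by
  have hproj : IsSelfAdjoint ((ℂ ∙ matUnit r j).starProjection : Tensor n d) :=
    isSelfAdjoint_starProjection _
  exact (IsSelfAdjoint.one _).add (.smul (conj_ofReal _) hproj)

lemma wave_frequency_zero_single (l : Fin d) (c : ℤ) (y : Pt d) :
    wave (frequency 0 (Pi.single l c)) y = cexp (((2 * Real.pi * c * y l : ℝ) : ℂ) * I) := by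
  rw [wave, mul_comm, Finset.sum_eq_single l]
  · simp [frequency_apply]
  · intro b _ hb
    simp [frequency_apply, Pi.single_eq_of_ne hb]
  · simp

lemma cos_eq_wave_add_wave (l : Fin d) (y : Pt d) :
    ((Real.cos (2 * Real.pi * y l) / 2 : ℝ) : ℂ) = 1 / 4 *
      (wave (frequency 0 (Pi.single l 1)) y + wave (frequency 0 (Pi.single l (-1))) y) := by
  rw [wave_frequency_zero_single, wave_frequency_zero_single]
  push_cast
  rw [Complex.cos]
  ring_nf

lemma inner_planeWave_of_mem_gradGraph {θ : Pt d} {k : Fin d → ℤ} {V : Mat n d}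
    (hV : ∀ v, inner ℂ (gradSymbol (frequency θ k) v) V = 0) {p : L2Vec n d × L2Mat n d}
    (hp : p ∈ gradGraph θ) : inner ℂ p.2 (planeWave (frequency θ k) V) = 0 := by
  rw [← inner_conj_symm, ← inner_waveCoeff_right, waveCoeff_snd_of_mem_gradGraph hp,
    inner_conj_symm, hV]

lemma inner_gradSymbol_starProjection_matUnit (r : Fin n) (hlj : l ≠ j) (c : ℤ) (v : Vec n)
    (X : Mat n d) : inner ℂ (gradSymbol (frequency 0 (Pi.single l c)) v)
      ((ℂ ∙ matUnit r j).starProjection X) = 0 := by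
  obtain ⟨b, hb⟩ := Submodule.mem_span_singleton.1
    (Submodule.starProjection_apply_mem (ℂ ∙ matUnit r j) X)
  rw [← hb, inner_smul_right, matUnit, EuclideanSpace.inner_single_right, gradSymbol_apply,
    frequency_apply, Pi.single_eq_of_ne hlj.symm]
  simp

lemma laminate_apply_ae_eq (r : Fin n) (l j : Fin d) (X : Mat n d) :
    (planeWave 0 X + (1 / 4 : ℂ) •
        (planeWave (frequency 0 (Pi.single l 1)) ((ℂ ∙ matUnit r j).starProjection X) +
          planeWave (frequency 0 (Pi.single l (-1))) ((ℂ ∙ matUnit r j).starProjection X)) :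
      L2Mat n d) =ᵐ[cellMeasure d] fun y => laminate r l j y X := by
  set Z := (ℂ ∙ matUnit r j).starProjection X
  set Wpos : L2Mat n d := planeWave (frequency 0 (Pi.single l 1)) Z
  set Wneg : L2Mat n d := planeWave (frequency 0 (Pi.single l (-1))) Z
  filter_upwards [Lp.coeFn_add (planeWave 0 X) ((1 / 4 : ℂ) • (Wpos + Wneg)),
    Lp.coeFn_smul (1 / 4 : ℂ) (Wpos + Wneg), Lp.coeFn_add Wpos Wneg, coeFn_planeWave 0 X,
    coeFn_planeWave (frequency 0 (Pi.single l 1)) Z,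
    coeFn_planeWave (frequency 0 (Pi.single l (-1))) Z] with y hadd hsmul hsum hX hpos hneg
  rw [hadd, Pi.add_apply, hsmul, Pi.smul_apply, hsum, Pi.add_apply, hX, hpos, hneg,
    laminate_apply, cos_eq_wave_add_wave, wave_zero_left, one_smul, ← add_smul, smul_smul]

lemma selfAdjointDivFree_laminate (r : Fin n) (hlj : l ≠ j) :
    SelfAdjointDivFree (laminate r l j) where
  periodicCoercive := periodicCoercive_laminate r l j
  selfAdjoint := .of_forall (isSelfAdjoint_laminate r l j)
  divFree X := by
    refine ⟨_, fun p hp => ?_, laminate_apply_ae_eq r l j X⟩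
    have hmean := inner_planeWave_of_mem_gradGraph (k := 0) (V := X)
      (fun v => by rw [frequency_zero_right, gradSymbol_zero_left, inner_zero_left]) hp
    have hosc : ∀ c, inner ℂ p.2 (planeWave (frequency 0 (Pi.single l c))
        ((ℂ ∙ matUnit r j).starProjection X)) = 0 := fun c =>
      inner_planeWave_of_mem_gradGraph
        (inner_gradSymbol_starProjection_matUnit r hlj c · X) hp
    rw [frequency_zero_right] at hmean
    rw [inner_add_right, inner_smul_right, inner_add_right, hmean, hosc, hosc, add_zero, mul_zero,
      add_zero, inner_zero_right, neg_zero]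

lemma not_isConstant_laminate (r : Fin n) (l j : Fin d) : ¬ IsConstant (laminate r l j) := by
  rintro ⟨A, hA⟩
  have hconst : laminate r l j = fun _ => A :=
    ((continuous_laminate r l j).ae_eq_iff_eq volume continuous_const).1 hA
  have heq : laminate r l j 0 (matUnit r j) =
      laminate r l j (EuclideanSpace.single l (1 / 2)) (matUnit r j) := by
    rw [hconst]
  have hproj : (ℂ ∙ matUnit r j).starProjection (matUnit r j) = matUnit r j :=
    Submodule.starProjection_eq_self_iff.2 (Submodule.mem_span_singleton_self _)
  have hπ : 2 * Real.pi * (1 / 2) = Real.pi := by ring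
  have hentry_one : (matUnit r j : Mat n d) (r, j) = 1 := by simp [matUnit]
  have hentry := congrArg (fun X : Mat n d => X (r, j)) heq
  simp only [laminate_apply, hproj, PiLp.add_apply, PiLp.smul_apply, PiLp.zero_apply,
    PiLp.single_apply, if_true, mul_zero, Real.cos_zero, hπ, Real.cos_pi, hentry_one] at hentry
  norm_num at hentry

end Laminate

end FibreHom

theorem proposition4p5 (n d : ℕ) :
    (∀ a : FibreHom.Pt d → FibreHom.Tensor n d, FibreHom.SelfAdjointDivFree a →
      -- the cell problems that define `a^hom(θ)` are uniquely solvable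
      (∀ θ ∈ FibreHom.quasimomenta d, ∀ (r : Fin n) (s : Fin d),
        ∃! p, FibreHom.IsCellSolution a θ r s p) ∧
      ((∀ θ ∈ FibreHom.quasimomenta d, θ ≠ 0 → FibreHom.aHom a θ = FibreHom.aHom a 0) ↔
        FibreHom.IsConstant a)) ∧
    -- the fibre-homogenised tensor differs from the classical one in general
    (1 ≤ n → 2 ≤ d →
      ∃ a : FibreHom.Pt d → FibreHom.Tensor n d, FibreHom.SelfAdjointDivFree a ∧
        ∃ θ ∈ FibreHom.quasimomenta d, θ ≠ 0 ∧ FibreHom.aHom a θ ≠ FibreHom.aHom a 0) := by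
  refine ⟨fun a ha => ⟨fun θ hθ r s =>
    FibreHom.existsUnique_isCellSolution ha.periodicCoercive hθ r s,
    ha.aHom_eq_iff_isConstant⟩, fun hn hd => ?_⟩
  have hne : (⟨0, by omega⟩ : Fin d) ≠ ⟨1, hd⟩ := by simp
  have hlaminate := FibreHom.selfAdjointDivFree_laminate (⟨0, hn⟩ : Fin n) hne
  refine ⟨_, hlaminate, ?_⟩
  by_contra! heq
  exact FibreHom.not_isConstant_laminate _ _ _ (hlaminate.aHom_eq_iff_isConstant.1 heq)
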